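/- Let $R$ be a commutative ring with unit, and let $\Lambda=\Lambda_R$ be the ring of symmetric functions over $R$ (for instance $R=\mathbb Z$ or $R=\mathbb Q$), i.e. the ring of formal power series of bounded degree in $x_1,x_2,\dots$ with coefficients in $R$ that are invariant under all permutations of the variables. Let $h_k\in\Lambda$ be the complete homogeneous symmetric function and $e_k\in\Lambda$ the elementary symmetric function of degree $k$, with $h_0=e_0=1$ and $h_k=e_k=0$ for $k<0$. Two matrices over a commutative ring $S$ are called stably equivalent if one can be transformed into the other by finitely many of the following operations: $M\mapsto AM$ and $M\mapsto MA$ with $A$ an invertible matrix over $S$; $M\mapsto\begin{pmatrix}1&0\\0&M\end{pmatrix}$; and the inverse of the last operation. Theorem. Let $\mu\subseteq\lambda$ be partitions, so that $\lambda/\mu$ is an arbitrary skew partition, not necessarily connected; let $\lambda',\mu'$ be the conjugate partitions and $\ell(\cdot)$ the number of parts, with $\mu_j=0$ for $j>\ell(\mu)$ and $\mu'_j=0$ for $j>\ell(\mu')$. Let $$J_{\lambda/\mu}=\bigl(h_{\lambda_i-\mu_j-i+j}\bigr)_{i,j=1}^{\ell(\lambda)},\qquad D_{\lambda/\mu}=\bigl(e_{\lambda'_i-\mu'_j-i+j}\bigr)_{i,j=1}^{\ell(\lambda')}$$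 be the Jacobi–Trudi matrix and the dual Jacobi–Trudi matrix. Then $J_{\lambda/\mu}$ and the transpose $D_{\lambda/\mu}^{T}=\bigl(e_{\lambda'_j-\mu'_i-j+i}\bigr)_{i,j=1}^{\ell(\lambda')}$ are stably equivalent over $\Lambda$. -/

import Mathlib

noncomputable section

open scoped Matrix

/-- The ring `Λ` of symmetric functions with coefficients in `R`: the formal power series of bounded
degree in the variables `x₀, x₁, x₂, …` that are invariant under every permutation of the
variables. -/
def SymmetricFunction (R : Type*) [CommRing R] : Subalgebra R (MvPowerSeries ℕ R) where
  carrier := {f | (∃ d : ℕ, ∀ m : ℕ →₀ ℕ, d < m.degree → MvPowerSeries.coeff m f = 0) ∧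
    ∀ (σ : Equiv.Perm ℕ) (m : ℕ →₀ ℕ),
      MvPowerSeries.coeff (m.mapDomain σ) f = MvPowerSeries.coeff m f}
  mul_mem' := by
    classical
    rintro f g ⟨⟨a, ha⟩, hf⟩ ⟨⟨b, hb⟩, hg⟩
    refine ⟨⟨a + b, fun m hm => ?_⟩, fun σ m => ?_⟩
    · rw [MvPowerSeries.coeff_mul]
      refine Finset.sum_eq_zero fun p hp => ?_
      rw [Finset.HasAntidiagonal.mem_antidiagonal] at hp
      have hdeg : p.1.degree + p.2.degree = m.degree := by rw [← hp, map_add]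
      rcases lt_or_ge a p.1.degree with h | h
      · rw [ha _ h, zero_mul]
      · rw [hb _ (by omega), mul_zero]
    · rw [MvPowerSeries.coeff_mul, MvPowerSeries.coeff_mul]
      symm
      refine Finset.sum_bij' (fun p _ => (p.1.mapDomain σ, p.2.mapDomain σ))
        (fun p _ => (p.1.mapDomain σ.symm, p.2.mapDomain σ.symm)) ?_ ?_ ?_ ?_ ?_
      · intro p hp
        rw [Finset.HasAntidiagonal.mem_antidiagonal] at hp ⊢
        rw [← hp, Finsupp.mapDomain_add]
      · intro p hp
        rw [Finset.HasAntidiagonal.mem_antidiagonal] at hp ⊢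
        rw [← Finsupp.mapDomain_add, hp, ← Finsupp.mapDomain_comp]
        simp
      · intro p _
        simp [← Finsupp.mapDomain_comp]
      · intro p _
        simp [← Finsupp.mapDomain_comp]
      · intro p _
        rw [hf, hg]
  add_mem' := by
    rintro f g ⟨⟨a, ha⟩, hf⟩ ⟨⟨b, hb⟩, hg⟩
    refine ⟨⟨a + b, fun m hm => ?_⟩, fun σ m => ?_⟩
    · rw [map_add, ha _ (by omega), hb _ (by omega), add_zero]
    · rw [map_add, map_add, hf, hg]
  algebraMap_mem' := by
    classical
    intro r
    refine ⟨⟨0, fun m hm => ?_⟩, fun σ m => ?_⟩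
    · rw [MvPowerSeries.algebraMap_apply, MvPowerSeries.coeff_C, if_neg]
      rintro rfl
      simp at hm
    · have key : m.mapDomain σ = 0 ↔ m = 0 := by
        rw [← Finsupp.mapDomain_zero (f := σ)]
        exact (Finsupp.mapDomain_injective σ.injective).eq_iff
      simp only [MvPowerSeries.algebraMap_apply, MvPowerSeries.coeff_C, key]

/-- The complete homogeneous symmetric function `h_k`, the sum of all monomials of degree `k`.
In particular `h_0 = 1`, and `h_k = 0` for `k < 0`. -/
def completeSymm (R : Type*) [CommRing R] (k : ℤ) : SymmetricFunction R :=
  ⟨fun m : ℕ →₀ ℕ => if (m.degree : ℤ) = k then 1 else 0, by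
    refine ⟨⟨k.toNat, fun m hm => ?_⟩, fun σ m => ?_⟩
    · exact if_neg (by omega)
    · change (if ((m.mapDomain σ).degree : ℤ) = k then (1 : R) else 0) =
        if (m.degree : ℤ) = k then 1 else 0
      rw [Finsupp.degree_mapDomain]⟩

open Classical in
/-- The elementary symmetric function `e_k`, the sum of all square-free monomials of degree `k`.
In particular `e_0 = 1`, and `e_k = 0` for `k < 0`. -/
def elemSymm (R : Type*) [CommRing R] (k : ℤ) : SymmetricFunction R :=
  ⟨fun m : ℕ →₀ ℕ => if (m.degree : ℤ) = k ∧ ∀ i, m i ≤ 1 then 1 else 0, by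
    refine ⟨⟨k.toNat, fun m hm => ?_⟩, fun σ m => ?_⟩
    · exact if_neg (by omega)
    · have key : (∀ i, m.mapDomain σ i ≤ 1) ↔ ∀ i, m i ≤ 1 := by
        rw [← σ.forall_congr_right]
        simp only [Finsupp.mapDomain_apply σ.injective]
      refine if_congr ?_ rfl rfl
      rw [Finsupp.degree_mapDomain, key]⟩

/-- The Jacobi–Trudi matrix `J_{λ/μ} = (h_{λ_i - μ_j - i + j})`, `1 ≤ i, j ≤ ℓ(λ)`.
Rows and columns are numbered from `0` here, which does not change `- i + j`;
`lam.rowLen i` is the part of `λ` in row `i`, and `lam.colLen 0 = ℓ(λ)`. -/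
def jacobiTrudi (R : Type*) [CommRing R] (lam mu : YoungDiagram) :
    Matrix (Fin (lam.colLen 0)) (Fin (lam.colLen 0)) (SymmetricFunction R) :=
  Matrix.of fun i j => completeSymm R ((lam.rowLen i : ℤ) - (mu.rowLen j : ℤ) - (i : ℤ) + (j : ℤ))

/-- The dual Jacobi–Trudi matrix `D_{λ/μ} = (e_{λ'_i - μ'_j - i + j})`, `1 ≤ i, j ≤ ℓ(λ')`, where
`λ'` and `μ'` are the conjugate partitions. -/
def dualJacobiTrudi (R : Type*) [CommRing R] (lam mu : YoungDiagram) :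
    Matrix (Fin (lam.transpose.colLen 0)) (Fin (lam.transpose.colLen 0)) (SymmetricFunction R) :=
  Matrix.of fun i j => elemSymm R
    ((lam.transpose.rowLen i : ℤ) - (mu.transpose.rowLen j : ℤ) - (i : ℤ) + (j : ℤ))

/-- The stabilization `(1 0; 0 M)` of a matrix `M`. -/
def stabilization {S : Type*} [CommRing S] {m n : ℕ} (M : Matrix (Fin m) (Fin n) S) :
    Matrix (Fin (1 + m)) (Fin (1 + n)) S :=
  Matrix.reindex finSumFinEquiv finSumFinEquiv
    (Matrix.fromBlocks (1 : Matrix (Fin 1) (Fin 1) S) 0 0 M)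

/-- The fundamental matrix operations, on matrices of all finite sizes: multiplication by an
invertible matrix on the left or on the right, and stabilization. -/
inductive StableStep (S : Type*) [CommRing S] :
    (Σ p : ℕ × ℕ, Matrix (Fin p.1) (Fin p.2) S) →
      (Σ p : ℕ × ℕ, Matrix (Fin p.1) (Fin p.2) S) → Prop
  | row {m n : ℕ} (A : Matrix (Fin m) (Fin m) S) (hA : IsUnit A) (M : Matrix (Fin m) (Fin n) S) :
      StableStep S ⟨(m, n), M⟩ ⟨(m, n), A * M⟩
  | col {m n : ℕ} (A : Matrix (Fin n) (Fin n) S) (hA : IsUnit A) (M : Matrix (Fin m) (Fin n) S) :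
      StableStep S ⟨(m, n), M⟩ ⟨(m, n), M * A⟩
  | stab {m n : ℕ} (M : Matrix (Fin m) (Fin n) S) :
      StableStep S ⟨(m, n), M⟩ ⟨(1 + m, 1 + n), stabilization M⟩

/-- Two matrices over a commutative ring are stably equivalent if one can be transformed into the
other by finitely many fundamental matrix operations and their inverses. -/
def StablyEquivalent {S : Type*} [CommRing S] {m n m' n' : ℕ}
    (M : Matrix (Fin m) (Fin n) S) (M' : Matrix (Fin m') (Fin n') S) : Prop :=
  Relation.EqvGen (StableStep S) ⟨(m, n), M⟩ ⟨(m', n'), M'⟩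

end

/-!
The matrices `H = (h_{p-q})` and `E = ((-1)^{p-q} e_{p-q})` of size `N = ℓ(λ) + ℓ(λ')` are inverse
to each other, because `∑ (-1)^k e_k h_{r-k} = 0` for `r > 0`. The matrix `J_{λ/μ}` is the submatrix
of `H` with rows `λ_i + ℓ(λ) - 1 - i` and columns `μ_j + ℓ(λ) - 1 - j`. The complement of
`{λ_i + ℓ(λ) - 1 - i}` in `{0, …, N - 1}` is `{ℓ(λ) + j - λ'_j}`, and likewise for `μ`
(`YoungDiagram.boundaryLabel_bijective`); so the complementary submatrix of `E` is, up to signs that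
are removed by diagonal matrices, the transpose of `D_{λ/μ}`.

It remains to see that complementary blocks of mutually inverse matrices are stably equivalent
(`IndexedStablyEquivalent.toBlocks_of_inverse`): if `A = (A₁₁ A₁₂; A₂₁ A₂₂)` has inverse
`B = (B₁₁ B₁₂; B₂₁ B₂₂)`, then
`A * (1 B₁₂; 0 B₂₂) = (A₁₁ 0; A₂₁ 1)`,
and the two matrices `(1 B₁₂; 0 B₂₂)` and `(A₁₁ 0; A₂₁ 1)` differ from `1 ⊕ B₂₂` and `A₁₁ ⊕ 1` by
invertible column operations.
-/

/-! ### Stable equivalence over arbitrary finite index types -/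

/-- Stable equivalence of matrices indexed by arbitrary finite types: every numbering of the rows
and columns yields stably equivalent matrices. -/
def IndexedStablyEquivalent {S : Type*} [CommRing S] {α β γ δ : Type}
    (M : Matrix α β S) (M' : Matrix γ δ S) : Prop :=
  ∀ ⦃m n m' n' : ℕ⦄ (e₁ : α ≃ Fin m) (e₂ : β ≃ Fin n) (e₃ : γ ≃ Fin m') (e₄ : δ ≃ Fin n'),
    StablyEquivalent (M.reindex e₁ e₂) (M'.reindex e₃ e₄)

section

variable {S : Type*} [CommRing S] {α β γ δ ε ζ : Type}

/-- Multiplication by an invertible matrix, whose rows and columns may be indexed by different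
types of the same size. -/
theorem StablyEquivalent.mul_left_of_inverse [Fintype α] [Fintype γ] [DecidableEq α]
    [DecidableEq γ] (e : α ≃ γ) {A : Matrix γ α S} {B : Matrix α γ S} (hAB : A * B = 1)
    (hBA : B * A = 1) (M : Matrix α β S) {m n m' : ℕ} (e₁ : α ≃ Fin m) (e₂ : β ≃ Fin n)
    (e₃ : γ ≃ Fin m') :
    StablyEquivalent (M.reindex e₁ e₂) ((A * M).reindex e₃ e₂) := by
  obtain rfl : m = m' := by simpa using Fintype.card_congr (e₁.symm.trans (e.trans e₃))
  have hu : IsUnit (A.submatrix e₃.symm e₁.symm) := by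
    refine ⟨⟨A.submatrix e₃.symm e₁.symm, B.submatrix e₁.symm e₃.symm, ?_, ?_⟩, rfl⟩
    · rw [Matrix.submatrix_mul_equiv, hAB, Matrix.submatrix_one_equiv]
    · rw [Matrix.submatrix_mul_equiv, hBA, Matrix.submatrix_one_equiv]
  have h := StableStep.row _ hu (M.submatrix e₁.symm e₂.symm)
  rw [Matrix.submatrix_mul_equiv] at h
  exact Relation.EqvGen.rel _ _ h

theorem StablyEquivalent.mul_right_of_inverse [Fintype β] [Fintype δ] [DecidableEq β]
    [DecidableEq δ] (e : β ≃ δ) {A : Matrix β δ S} {B : Matrix δ β S} (hAB : A * B = 1)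
    (hBA : B * A = 1) (M : Matrix α β S) {m n n' : ℕ} (e₁ : α ≃ Fin m) (e₂ : β ≃ Fin n)
    (e₄ : δ ≃ Fin n') :
    StablyEquivalent (M.reindex e₁ e₂) ((M * A).reindex e₁ e₄) := by
  obtain rfl : n = n' := by simpa using Fintype.card_congr (e₂.symm.trans (e.trans e₄))
  have hu : IsUnit (A.submatrix e₂.symm e₄.symm) := by
    refine ⟨⟨A.submatrix e₂.symm e₄.symm, B.submatrix e₄.symm e₂.symm, ?_, ?_⟩, rfl⟩
    · rw [Matrix.submatrix_mul_equiv, hAB, Matrix.submatrix_one_equiv]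
    · rw [Matrix.submatrix_mul_equiv, hBA, Matrix.submatrix_one_equiv]
  have h := StableStep.col _ hu (M.submatrix e₁.symm e₂.symm)
  rw [Matrix.submatrix_mul_equiv] at h
  exact Relation.EqvGen.rel _ _ h

namespace IndexedStablyEquivalent

theorem refl [Finite α] [Finite β] (M : Matrix α β S) : IndexedStablyEquivalent M M := by
  classical
  have := Fintype.ofFinite α
  have := Fintype.ofFinite β
  intro m n m' n' e₁ e₂ e₃ e₄
  have h₁ := StablyEquivalent.mul_left_of_inverse (.refl α) (one_mul 1) (one_mul 1) M e₁ e₂ e₃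
  have h₂ := StablyEquivalent.mul_right_of_inverse (.refl β) (one_mul 1) (one_mul 1) M e₃ e₂ e₄
  rw [Matrix.one_mul] at h₁
  rw [Matrix.mul_one] at h₂
  exact h₁.trans _ _ _ h₂

theorem symm {M : Matrix α β S} {M' : Matrix γ δ S} (h : IndexedStablyEquivalent M M') :
    IndexedStablyEquivalent M' M :=
  fun _ _ _ _ e₁ e₂ e₃ e₄ => (h e₃ e₄ e₁ e₂).symm

theorem trans [Finite γ] [Finite δ] {M : Matrix α β S} {M' : Matrix γ δ S} {M'' : Matrix ε ζ S}
    (h : IndexedStablyEquivalent M M') (h' : IndexedStablyEquivalent M' M'') :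
    IndexedStablyEquivalent M M'' :=
  fun _ _ _ _ e₁ e₂ e₃ e₄ =>
    (h e₁ e₂ (Finite.equivFin γ) (Finite.equivFin δ)).trans _ _ _ (h' _ _ e₃ e₄)

theorem of_numbering [Finite α] [Finite β] [Finite γ] [Finite δ] {M : Matrix α β S}
    {M' : Matrix γ δ S} {m n m' n' : ℕ} (e₁ : α ≃ Fin m) (e₂ : β ≃ Fin n) (e₃ : γ ≃ Fin m')
    (e₄ : δ ≃ Fin n') (h : StablyEquivalent (M.reindex e₁ e₂) (M'.reindex e₃ e₄)) :
    IndexedStablyEquivalent M M' := fun _ _ _ _ f₁ f₂ f₃ f₄ =>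
  (refl M f₁ f₂ e₁ e₂).trans _ _ _ (h.trans _ _ _ (refl M' e₃ e₄ f₃ f₄))

theorem reindex [Finite α] [Finite β] (M : Matrix α β S) (e : α ≃ γ) (f : β ≃ δ) :
    IndexedStablyEquivalent M (M.reindex e f) :=
  fun _ _ _ _ e₁ e₂ e₃ e₄ => refl M e₁ e₂ (e.trans e₃) (f.trans e₄)

theorem mul_left [Fintype α] [Fintype γ] [Finite β] [DecidableEq α] [DecidableEq γ] (e : α ≃ γ)
    {A : Matrix γ α S} {B : Matrix α γ S} (hAB : A * B = 1) (hBA : B * A = 1)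
    (M : Matrix α β S) : IndexedStablyEquivalent M (A * M) :=
  of_numbering _ (Finite.equivFin β) _ _ (StablyEquivalent.mul_left_of_inverse e hAB hBA M
    (Fintype.equivFin α) _ (Fintype.equivFin γ))

theorem mul_right [Fintype β] [Fintype δ] [Finite α] [DecidableEq β] [DecidableEq δ] (e : β ≃ δ)
    {A : Matrix β δ S} {B : Matrix δ β S} (hAB : A * B = 1) (hBA : B * A = 1)
    (M : Matrix α β S) : IndexedStablyEquivalent M (M * A) :=
  of_numbering (Finite.equivFin α) _ _ _ (StablyEquivalent.mul_right_of_inverse e hAB hBA M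
    _ (Fintype.equivFin β) (Fintype.equivFin δ))

theorem fromBlocks_one_fin_one [Finite α] [Finite β] (M : Matrix α β S) :
    IndexedStablyEquivalent M (Matrix.fromBlocks (1 : Matrix (Fin 1) (Fin 1) S) 0 0 M) := by
  have h := StableStep.stab (M.reindex (Finite.equivFin α) (Finite.equivFin β))
  refine of_numbering (Finite.equivFin α) (Finite.equivFin β)
    (((Equiv.refl _).sumCongr (Finite.equivFin α)).trans finSumFinEquiv)
    (((Equiv.refl _).sumCongr (Finite.equivFin β)).trans finSumFinEquiv)
    (Relation.EqvGen.rel _ _ ?_)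
  convert h using 2
  unfold stabilization
  ext i j
  obtain ⟨i, rfl⟩ := finSumFinEquiv.surjective i
  obtain ⟨j, rfl⟩ := finSumFinEquiv.surjective j
  rcases i with i | i <;> rcases j with j | j <;> simp [Matrix.reindex_apply]

theorem fromBlocks_one_fin [Finite α] [Finite β] (M : Matrix α β S) (c : ℕ) :
    IndexedStablyEquivalent M (Matrix.fromBlocks (1 : Matrix (Fin c) (Fin c) S) 0 0 M) := by
  induction c with
  | zero =>
    convert reindex M (Equiv.emptySum (Fin 0) α).symm (Equiv.emptySum (Fin 0) β).symm using 1
    ext (i | i) (j | j)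
    · exact i.elim0
    · exact i.elim0
    · exact j.elim0
    · simp
  | succ c ih =>
    refine (ih.trans (fromBlocks_one_fin_one _)).trans ?_
    let e : Fin 1 ⊕ Fin c ≃ Fin (c + 1) := finSumFinEquiv.trans (finCongr (Nat.add_comm 1 c))
    convert reindex _ ((Equiv.sumAssoc (Fin 1) (Fin c) α).symm.trans (e.sumCongr (.refl _)))
      ((Equiv.sumAssoc (Fin 1) (Fin c) β).symm.trans (e.sumCongr (.refl _))) using 1
    ext (i | i) (j | j)
    · obtain ⟨i, rfl⟩ := e.surjective i
      obtain ⟨j, rfl⟩ := e.surjective j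
      rcases i with i | i <;> rcases j with j | j <;>
        simp [Matrix.one_apply, Matrix.reindex_apply]
    · obtain ⟨i, rfl⟩ := e.surjective i
      rcases i with i | i <;> simp [Matrix.reindex_apply]
    · obtain ⟨j, rfl⟩ := e.surjective j
      rcases j with j | j <;> simp [Matrix.reindex_apply]
    · simp [Matrix.reindex_apply]

theorem fromBlocks_one [Fintype γ] [DecidableEq γ] [Finite α] [Finite β] (M : Matrix α β S) :
    IndexedStablyEquivalent M (Matrix.fromBlocks (1 : Matrix γ γ S) 0 0 M) := by
  refine (fromBlocks_one_fin M (Fintype.card γ)).trans ?_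
  convert reindex (Matrix.fromBlocks 1 0 0 M) ((Fintype.equivFin γ).symm.sumCongr (.refl α))
    ((Fintype.equivFin γ).symm.sumCongr (.refl β)) using 1
  ext (i | i) (j | j) <;> simp [Matrix.reindex_apply, Matrix.one_apply]

/-- Complementary blocks of two mutually inverse matrices are stably equivalent. -/
theorem toBlocks_of_inverse [Fintype α] [Fintype β] [Fintype γ] [Fintype δ] [DecidableEq α]
    [DecidableEq β] [DecidableEq γ] [DecidableEq δ] (e : γ ⊕ δ ≃ α ⊕ β)
    {A : Matrix (α ⊕ β) (γ ⊕ δ) S} {B : Matrix (γ ⊕ δ) (α ⊕ β) S} (hAB : A * B = 1)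
    (hBA : B * A = 1) : IndexedStablyEquivalent A.toBlocks₁₁ B.toBlocks₂₂ := by
  -- The blocks in the second column of `A * B = 1`.
  have h₁₂ : A.toBlocks₁₁ * B.toBlocks₁₂ + A.toBlocks₁₂ * B.toBlocks₂₂ = 0 := by
    have h := congrArg Matrix.toBlocks₁₂ hAB
    rwa [← A.fromBlocks_toBlocks, ← B.fromBlocks_toBlocks, Matrix.fromBlocks_multiply,
      ← Matrix.fromBlocks_one, Matrix.toBlocks_fromBlocks₁₂, Matrix.toBlocks_fromBlocks₁₂] at h
  have h₂₂ : A.toBlocks₂₁ * B.toBlocks₁₂ + A.toBlocks₂₂ * B.toBlocks₂₂ = 1 := by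
    have h := congrArg Matrix.toBlocks₂₂ hAB
    rwa [← A.fromBlocks_toBlocks, ← B.fromBlocks_toBlocks, Matrix.fromBlocks_multiply,
      ← Matrix.fromBlocks_one, Matrix.toBlocks_fromBlocks₂₂, Matrix.toBlocks_fromBlocks₂₂] at h
  have key : A * Matrix.fromBlocks (1 : Matrix γ γ S) B.toBlocks₁₂ 0 B.toBlocks₂₂ =
      Matrix.fromBlocks A.toBlocks₁₁ 0 A.toBlocks₂₁ (1 : Matrix β β S) := by
    conv_lhs => rw [← A.fromBlocks_toBlocks]
    rw [Matrix.fromBlocks_multiply, h₁₂, h₂₂]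
    simp
  have hA : IndexedStablyEquivalent A.toBlocks₁₁
      (Matrix.fromBlocks A.toBlocks₁₁ 0 A.toBlocks₂₁ (1 : Matrix β β S)) := by
    have h := (fromBlocks_one (γ := β) A.toBlocks₁₁).trans
      (reindex _ (Equiv.sumComm _ _) (Equiv.sumComm _ _))
    have hswap : (Matrix.fromBlocks 1 0 0 A.toBlocks₁₁).reindex (Equiv.sumComm _ _)
        (Equiv.sumComm _ _) = Matrix.fromBlocks A.toBlocks₁₁ 0 0 (1 : Matrix β β S) :=
      Matrix.fromBlocks_submatrix_sum_swap_sum_swap _ _ _ _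
    rw [hswap] at h
    have h' := mul_right (.refl (γ ⊕ β)) (A := Matrix.fromBlocks 1 0 A.toBlocks₂₁ 1)
      (B := Matrix.fromBlocks 1 0 (-A.toBlocks₂₁) 1) (by simp [Matrix.fromBlocks_multiply])
      (by simp [Matrix.fromBlocks_multiply]) (Matrix.fromBlocks A.toBlocks₁₁ 0 0 (1 : Matrix β β S))
    refine h.trans ?_
    simpa [Matrix.fromBlocks_multiply] using h'
  have hB : IndexedStablyEquivalent B.toBlocks₂₂
      (Matrix.fromBlocks (1 : Matrix γ γ S) B.toBlocks₁₂ 0 B.toBlocks₂₂) := by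
    have h' := mul_right (.refl (γ ⊕ β)) (A := Matrix.fromBlocks 1 B.toBlocks₁₂ 0 1)
      (B := Matrix.fromBlocks 1 (-B.toBlocks₁₂) 0 1) (by simp [Matrix.fromBlocks_multiply])
      (by simp [Matrix.fromBlocks_multiply]) (Matrix.fromBlocks (1 : Matrix γ γ S) 0 0 B.toBlocks₂₂)
    refine (fromBlocks_one (γ := γ) B.toBlocks₂₂).trans ?_
    simpa [Matrix.fromBlocks_multiply] using h'
  have hmul := mul_left e hAB hBA (Matrix.fromBlocks (1 : Matrix γ γ S) B.toBlocks₁₂ 0 B.toBlocks₂₂)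
  rw [key] at hmul
  exact hA.trans (hmul.symm.trans hB.symm)

end IndexedStablyEquivalent

end

theorem diagonal_neg_one_pow_mul_self {S α : Type*} [CommRing S] [Fintype α] [DecidableEq α]
    (f : α → ℕ) :
    (Matrix.diagonal fun i => (-1 : S) ^ f i) * (Matrix.diagonal fun i => (-1) ^ f i) = 1 := by
  rw [Matrix.diagonal_mul_diagonal, ← Matrix.diagonal_one]
  congr 1
  ext i
  rw [← mul_pow]
  simp

/-- Changing the signs of some rows and columns does not affect the stable equivalence class. -/
theorem IndexedStablyEquivalent.neg_one_pow_mul {S : Type*} [CommRing S] {α β : Type} [Finite α]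
    [Finite β] (f : α → ℕ) (g : β → ℕ) (M : Matrix α β S) :
    IndexedStablyEquivalent (Matrix.of fun i j => (-1) ^ (f i + g j) * M i j) M := by
  classical
  have := Fintype.ofFinite α
  have := Fintype.ofFinite β
  have h := (mul_left (.refl α) (diagonal_neg_one_pow_mul_self f)
    (diagonal_neg_one_pow_mul_self f) M).trans (mul_right (.refl β)
      (diagonal_neg_one_pow_mul_self g) (diagonal_neg_one_pow_mul_self g) _)
  convert h.symm using 1
  ext i j
  rw [Matrix.mul_diagonal, Matrix.diagonal_mul, Matrix.of_apply, pow_add]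
  ring

/-! ### The relation between elementary and complete symmetric functions -/

open Classical in
/-- Among the factorizations `m = p * q` of a monomial with `p` square-free, there are as many with
`p` of even degree as with `p` of odd degree, unless `m = 1`: such `p` are the subsets of the
support of `m`. -/
theorem sum_antidiagonal_squarefree_neg_one_pow (R : Type*) [CommRing R] (m : ℕ →₀ ℕ) :
    ∑ p ∈ Finset.HasAntidiagonal.antidiagonal m with ∀ i, p.1 i ≤ 1, (-1 : R) ^ p.1.degree =
      if m = 0 then 1 else 0 := by
  classical
  have h : ∑ s ∈ m.support.powerset, (-1 : R) ^ s.card = if m = 0 then 1 else 0 := by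
    have := Finset.sum_powerset_neg_one_pow_card (x := m.support)
    simp only [Finsupp.support_eq_empty] at this
    have := congrArg (Int.cast : ℤ → R) this
    push_cast at this
    exact this
  rw [← h]
  have hle {p : (ℕ →₀ ℕ) × (ℕ →₀ ℕ)} (hp : p.1 + p.2 = m) (i : ℕ) : p.1 i + p.2 i = m i := by
    rw [← hp, Finsupp.add_apply]
  refine Finset.sum_bij' (fun p _ => p.1.support)
    (fun s _ => (Finsupp.indicator s fun _ _ => 1, m - Finsupp.indicator s fun _ _ => 1))
    ?_ ?_ ?_ ?_ ?_
  · intro p hp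
    rw [Finset.mem_filter, Finset.HasAntidiagonal.mem_antidiagonal] at hp
    rw [Finset.mem_powerset]
    intro i hi
    rw [Finsupp.mem_support_iff] at hi ⊢
    have := hle hp.1 i
    omega
  · intro s hs
    rw [Finset.mem_powerset] at hs
    rw [Finset.mem_filter, Finset.HasAntidiagonal.mem_antidiagonal]
    refine ⟨add_tsub_cancel_of_le fun i => ?_, fun i => ?_⟩
    · rw [Finsupp.indicator_apply]
      split_ifs with hi
      · exact Nat.one_le_iff_ne_zero.2 (Finsupp.mem_support_iff.1 (hs hi))
      · exact Nat.zero_le _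
    · rw [Finsupp.indicator_apply]
      split_ifs <;> simp
  · intro p hp
    rw [Finset.mem_filter, Finset.HasAntidiagonal.mem_antidiagonal] at hp
    have h1 : (Finsupp.indicator p.1.support fun _ _ => 1) = p.1 := by
      ext i
      rw [Finsupp.indicator_apply]
      have := hp.2 i
      split_ifs with hi <;> rw [Finsupp.mem_support_iff] at hi <;> omega
    ext1
    · exact h1
    · change m - (Finsupp.indicator p.1.support fun _ _ => 1) = p.2
      rw [h1, ← hp.1, add_tsub_cancel_left]
  · intro s hs
    ext i
    simp [Finsupp.indicator_apply]
  · intro p hp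
    rw [Finset.mem_filter] at hp
    congr 1
    rw [Finsupp.degree_apply, Finset.card_eq_sum_ones]
    refine Finset.sum_congr rfl fun i hi => ?_
    have := hp.2 i
    rw [Finsupp.mem_support_iff] at hi
    omega

theorem coeff_completeSymm (R : Type*) [CommRing R] (k : ℤ) (m : ℕ →₀ ℕ) :
    MvPowerSeries.coeff m (completeSymm R k : MvPowerSeries ℕ R) =
      if (m.degree : ℤ) = k then 1 else 0 := rfl

open Classical in
theorem coeff_elemSymm (R : Type*) [CommRing R] (k : ℤ) (m : ℕ →₀ ℕ) :
    MvPowerSeries.coeff m (elemSymm R k : MvPowerSeries ℕ R) =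
      if (m.degree : ℤ) = k ∧ ∀ i, m i ≤ 1 then 1 else 0 := rfl

theorem completeSymm_of_neg (R : Type*) [CommRing R] {k : ℤ} (hk : k < 0) :
    completeSymm R k = 0 := by
  ext m
  rw [coeff_completeSymm, if_neg (by omega)]
  rfl

theorem elemSymm_of_neg (R : Type*) [CommRing R] {k : ℤ} (hk : k < 0) : elemSymm R k = 0 := by
  ext m
  rw [coeff_elemSymm, if_neg (by omega)]
  rfl

theorem sum_neg_one_pow_mul_elemSymm_mul_completeSymm (R : Type*) [CommRing R] (r : ℕ) :
    ∑ k ∈ Finset.range (r + 1), (-1) ^ k * elemSymm R k * completeSymm R ((r : ℤ) - k) =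
      if r = 0 then 1 else 0 := by
  classical
  ext m
  have hL : MvPowerSeries.coeff m ((∑ k ∈ Finset.range (r + 1),
        (-1) ^ k * elemSymm R k * completeSymm R ((r : ℤ) - k) : SymmetricFunction R) :
        MvPowerSeries ℕ R) =
      ∑ p ∈ Finset.HasAntidiagonal.antidiagonal m with ∀ i, p.1 i ≤ 1,
        if m.degree = r then (-1 : R) ^ p.1.degree else 0 := by
    have hterm (k : ℕ) : MvPowerSeries.coeff m (((-1) ^ k * elemSymm R k *
          completeSymm R ((r : ℤ) - k) : SymmetricFunction R) : MvPowerSeries ℕ R) =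
        ∑ p ∈ Finset.HasAntidiagonal.antidiagonal m, (-1) ^ k *
          ((if (p.1.degree : ℤ) = k ∧ ∀ i, p.1 i ≤ 1 then 1 else 0) *
            if (p.2.degree : ℤ) = r - k then 1 else 0) := by
      have h : (((-1) ^ k * elemSymm R k * completeSymm R ((r : ℤ) - k) : SymmetricFunction R) :
          MvPowerSeries ℕ R) =
          MvPowerSeries.C ((-1) ^ k) * ((elemSymm R k : MvPowerSeries ℕ R) *
            (completeSymm R ((r : ℤ) - k) : MvPowerSeries ℕ R)) := by
        push_cast
        simp [mul_assoc]
      rw [h, MvPowerSeries.coeff_C_mul, MvPowerSeries.coeff_mul, Finset.mul_sum]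
      rfl
    rw [AddSubmonoidClass.coe_finsetSum, map_sum, Finset.sum_congr rfl fun k _ => hterm k,
      Finset.sum_comm, Finset.sum_filter]
    refine Finset.sum_congr rfl fun p hp => ?_
    rw [Finset.HasAntidiagonal.mem_antidiagonal] at hp
    have hdeg : p.1.degree + p.2.degree = m.degree := by rw [← hp, map_add]
    by_cases hs : ∀ i, p.1 i ≤ 1
    · rw [if_pos hs]
      split_ifs with hr
      · rw [Finset.sum_eq_single p.1.degree]
        · rw [if_pos ⟨rfl, hs⟩, if_pos (by omega), mul_one, mul_one]
        · intro k _ hk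
          rw [if_neg (by omega), zero_mul, mul_zero]
        · intro hk
          rw [Finset.mem_range] at hk
          omega
      · refine Finset.sum_eq_zero fun k _ => ?_
        by_cases h1 : (p.1.degree : ℤ) = k
        · rw [if_neg (c := (p.2.degree : ℤ) = r - k) (by omega), mul_zero, mul_zero]
        · rw [if_neg (by tauto), zero_mul, mul_zero]
    · rw [if_neg hs]
      refine Finset.sum_eq_zero fun k _ => ?_
      rw [if_neg (by tauto), zero_mul, mul_zero]
  rw [hL]
  by_cases hr : m.degree = r
  · simp only [if_pos hr]
    rw [sum_antidiagonal_squarefree_neg_one_pow]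
    have hm : m = 0 ↔ r = 0 := by rw [← hr, Finsupp.degree_eq_zero_iff]
    by_cases h0 : r = 0
    · rw [if_pos h0, if_pos (hm.2 h0), hm.2 h0]
      simp
    · rw [if_neg h0, if_neg (hm.not.2 h0)]
      simp
  · simp only [if_neg hr, Finset.sum_const_zero]
    by_cases h0 : r = 0
    · have hm : m ≠ 0 := by
        rintro rfl
        exact hr (by simp [h0])
      rw [if_pos h0]
      simp [MvPowerSeries.coeff_one, hm]
    · rw [if_neg h0]
      simp

/-- The lower triangular Toeplitz matrix `(h_{p-q})` of size `N`. -/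
noncomputable def completeToeplitz (R : Type*) [CommRing R] (N : ℕ) :
    Matrix (Fin N) (Fin N) (SymmetricFunction R) :=
  Matrix.of fun p q => completeSymm R ((p : ℤ) - q)

/-- The lower triangular Toeplitz matrix `((-1)^{p-q} e_{p-q})` of size `N`. The sign is written
with exponent `p + q`, which is a natural number. -/
noncomputable def signedElemToeplitz (R : Type*) [CommRing R] (N : ℕ) :
    Matrix (Fin N) (Fin N) (SymmetricFunction R) :=
  Matrix.of fun p q => (-1) ^ ((p : ℕ) + q) * elemSymm R ((p : ℤ) - q)

theorem signedElemToeplitz_mul_completeToeplitz (R : Type*) [CommRing R] (N : ℕ) :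
    signedElemToeplitz R N * completeToeplitz R N = 1 := by
  ext1 p q
  rw [Matrix.mul_apply]
  simp only [signedElemToeplitz, completeToeplitz, Matrix.of_apply]
  rcases lt_or_ge p q with hpq | hpq
  · rw [Matrix.one_apply_ne hpq.ne]
    refine Finset.sum_eq_zero fun s _ => ?_
    rcases lt_or_ge p s with h | h
    · rw [elemSymm_of_neg R (by omega), mul_zero, zero_mul]
    · rw [completeSymm_of_neg R (by omega), mul_zero]
  · obtain ⟨r, hr⟩ : ∃ r : ℕ, (p : ℕ) = q + r := Nat.exists_eq_add_of_le hpq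
    have h := sum_neg_one_pow_mul_elemSymm_mul_completeSymm R r
    have h1 : (1 : Matrix (Fin N) (Fin N) (SymmetricFunction R)) p q =
        if r = 0 then 1 else 0 := by
      rw [Matrix.one_apply]
      exact if_congr (by rw [Fin.ext_iff]; omega) rfl rfl
    rw [h1, ← h]
    symm
    -- Only the indices `s = p - k` with `q ≤ s ≤ p` contribute.
    refine Finset.sum_of_injOn (fun k => (⟨p - k, by omega⟩ : Fin N)) ?_ ?_ ?_ ?_
    · intro a ha b hb hab
      simp only [Finset.coe_range, Set.mem_Iio, Fin.mk.injEq] at ha hb hab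
      omega
    · intro k _
      simp
    · intro s _ hs
      rcases lt_or_ge p s with h | h
      · rw [elemSymm_of_neg R (by omega), mul_zero, zero_mul]
      · rcases lt_or_ge s q with h' | h'
        · rw [completeSymm_of_neg R (by omega), mul_zero]
        · refine absurd ⟨(p : ℕ) - s, ?_, ?_⟩ hs
          · simp only [Finset.coe_range, Set.mem_Iio]
            omega
          · ext
            simp only
            omega
    · intro k hk
      rw [Finset.mem_range] at hk
      have heven : Even ((p : ℕ) + (p - k)) ↔ Even k := by
        rw [show (p : ℕ) + (p - k) = k + 2 * (p - k) by omega, Nat.even_add]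
        simp
      have hsign : (-1 : SymmetricFunction R) ^ ((p : ℕ) + (p - k)) = (-1) ^ k :=
        neg_one_pow_congr (R := SymmetricFunction R) heven
      simp only [hsign]
      rw [show ((p : ℕ) : ℤ) - ((p - k : ℕ) : ℤ) = k by omega,
        show ((p - k : ℕ) : ℤ) - (q : ℕ) = r - k by omega]

theorem completeToeplitz_mul_signedElemToeplitz (R : Type*) [CommRing R] (N : ℕ) :
    completeToeplitz R N * signedElemToeplitz R N = 1 :=
  mul_eq_one_comm.1 (signedElemToeplitz_mul_completeToeplitz R N)

/-! ### Young diagrams in a rectangle -/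

namespace YoungDiagram

theorem rowLen_le_of_le {mu lam : YoungDiagram} (h : mu ≤ lam) (i : ℕ) :
    mu.rowLen i ≤ lam.rowLen i := by
  by_contra! hlt
  exact lt_irrefl _ (mem_iff_lt_rowLen.1 (h (mem_iff_lt_rowLen.2 hlt)))

theorem colLen_le_of_le {mu lam : YoungDiagram} (h : mu ≤ lam) (j : ℕ) :
    mu.colLen j ≤ lam.colLen j := by
  by_contra! hlt
  exact lt_irrefl _ (mem_iff_lt_colLen.1 (h (mem_iff_lt_colLen.2 hlt)))

variable (nu : YoungDiagram) {n m : ℕ}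

/-- The labels of the boundary path of a diagram inside an `n × m` rectangle, whose `n + m` steps
are numbered `0, …, n + m - 1` from the bottom left corner: row `i` contributes the vertical step
`ν_i + n - 1 - i` and column `j` the horizontal step `n + j - ν'_j`. -/
def boundaryLabel (hn : nu.colLen 0 ≤ n) (hm : nu.rowLen 0 ≤ m) : Fin n ⊕ Fin m → Fin (n + m) :=
  Sum.elim
    (fun i => ⟨nu.rowLen i + (n - 1 - i), by
      have := nu.rowLen_anti 0 i (Nat.zero_le _)
      omega⟩)
    (fun j => ⟨n + j - nu.colLen j, by omega⟩)

theorem boundaryLabel_bijective (hn : nu.colLen 0 ≤ n) (hm : nu.rowLen 0 ≤ m) :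
    Function.Bijective (nu.boundaryLabel hn hm) := by
  rw [Fintype.bijective_iff_injective_and_card]
  refine ⟨?_, by simp⟩
  have hcol (j : ℕ) : nu.colLen j ≤ n := (nu.colLen_anti 0 j (Nat.zero_le _)).trans hn
  -- A coincidence would give `ν_i + ν'_j = i + j + 1`, but this sum is at least `i + j + 2` for
  -- cells `(i, j)` of the diagram and at most `i + j` for the others.
  have hne (i : Fin n) (j : Fin m) :
      nu.rowLen i + (n - 1 - i) ≠ n + j - nu.colLen j := by
    have := hcol j
    by_cases hij : ((i : ℕ), (j : ℕ)) ∈ nu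
    · have h1 := mem_iff_lt_rowLen.1 hij
      have h2 := mem_iff_lt_colLen.1 hij
      omega
    · have h1 := mem_iff_lt_rowLen.not.1 hij
      have h2 := mem_iff_lt_colLen.not.1 hij
      omega
  rintro (i | i) (j | j) h <;> simp only [boundaryLabel, Sum.elim_inl, Sum.elim_inr,
    Fin.mk.injEq] at h
  · congr 1
    ext
    rcases lt_trichotomy (i : ℕ) j with hij | hij | hij
    · have := nu.rowLen_anti i j hij.le
      omega
    · exact hij
    · have := nu.rowLen_anti j i hij.le
      omega
  · exact absurd h (hne i j)
  · exact absurd h.symm (hne j i)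
  · congr 1
    ext
    have := hcol i
    have := hcol j
    rcases lt_trichotomy (i : ℕ) j with hij | hij | hij
    · have := nu.colLen_anti i j hij.le
      omega
    · exact hij
    · have := nu.colLen_anti j i hij.le
      omega

/-- The boundary labelling of `boundaryLabel` as an equivalence. -/
noncomputable def boundaryEquiv (hn : nu.colLen 0 ≤ n) (hm : nu.rowLen 0 ≤ m) : Fin n ⊕ Fin m ≃ Fin (n + m) :=
  Equiv.ofBijective _ (nu.boundaryLabel_bijective hn hm)

theorem coe_boundaryEquiv_inl (hn : nu.colLen 0 ≤ n) (hm : nu.rowLen 0 ≤ m) (i : Fin n) :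
    (nu.boundaryEquiv hn hm (.inl i) : ℤ) = nu.rowLen i + (n - 1 - i) := by
  change ((nu.rowLen i + (n - 1 - i) : ℕ) : ℤ) = _
  omega

theorem coe_boundaryEquiv_inr (hn : nu.colLen 0 ≤ n) (hm : nu.rowLen 0 ≤ m) (j : Fin m) :
    (nu.boundaryEquiv hn hm (.inr j) : ℤ) = n + j - nu.colLen j := by
  change ((n + j - nu.colLen j : ℕ) : ℤ) = _
  have := nu.colLen_anti 0 j (Nat.zero_le _)
  omega

end YoungDiagram

/-! ### The Jacobi–Trudi matrices as complementary submatrices -/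

theorem mainTheorem1 (R : Type*) [CommRing R] (lam mu : YoungDiagram) (hle : mu ≤ lam) :
    StablyEquivalent (jacobiTrudi R lam mu) (dualJacobiTrudi R lam mu).transpose := by
  have hrow : lam.rowLen 0 ≤ lam.transpose.colLen 0 := by rw [YoungDiagram.colLen_transpose]
  set σ := lam.boundaryEquiv le_rfl hrow with hσ
  set τ := mu.boundaryEquiv (YoungDiagram.colLen_le_of_le hle 0)
    ((YoungDiagram.rowLen_le_of_le hle 0).trans hrow) with hτ
  have h := IndexedStablyEquivalent.toBlocks_of_inverse (τ.trans σ.symm)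
    (A := (completeToeplitz R _).submatrix σ τ) (B := (signedElemToeplitz R _).submatrix τ σ)
    (by rw [Matrix.submatrix_mul_equiv, completeToeplitz_mul_signedElemToeplitz,
      Matrix.submatrix_one_equiv])
    (by rw [Matrix.submatrix_mul_equiv, signedElemToeplitz_mul_completeToeplitz,
      Matrix.submatrix_one_equiv])
  have hJ : ((completeToeplitz R _).submatrix σ τ).toBlocks₁₁ = jacobiTrudi R lam mu := by
    ext1 i j
    change completeSymm R ((σ (.inl i) : ℕ) - (τ (.inl j) : ℕ)) = completeSymm R _
    rw [hσ, hτ, YoungDiagram.coe_boundaryEquiv_inl, YoungDiagram.coe_boundaryEquiv_inl]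
    congr 1
    ring
  have hD : ((signedElemToeplitz R _).submatrix τ σ).toBlocks₂₂ = Matrix.of fun i j =>
      (-1) ^ ((τ (.inr i) : ℕ) + (σ (.inr j) : ℕ)) * (dualJacobiTrudi R lam mu).transpose i j := by
    ext1 i j
    change _ * elemSymm R ((τ (.inr i) : ℕ) - (σ (.inr j) : ℕ)) = _ * elemSymm R _
    congr 2
    rw [hσ, hτ, YoungDiagram.coe_boundaryEquiv_inr, YoungDiagram.coe_boundaryEquiv_inr,
      YoungDiagram.rowLen_transpose, YoungDiagram.rowLen_transpose]
    ring
  rw [hJ, hD] at h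
  exact h.trans (IndexedStablyEquivalent.neg_one_pow_mul _ _ _) (.refl _) (.refl _) (.refl _)
    (.refl _)
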